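/- Let $\lambda$ be a Young diagram with $n$ boxes (the empty diagram allowed), with row lengths $\lambda_1\ge\lambda_2\ge\cdots$, let $0\le l\le n$ and let $\pi\in S_l$, regarded also as an element of $S_n$ that fixes $l+1,\dots,n$. Let $\rho^\lambda$ be the irreducible complex representation of $S_n$ associated with $\lambda$: number the boxes of $\lambda$ by $1,\dots,n$ in any way, put $c=ba\in\mathbb{C}[S_n]$, where $a=\sum_\sigma\sigma$ over all $\sigma\in S_n$ that preserve each row of $\lambda$ and $b=\sum_\sigma\operatorname{sgn}(\sigma)\,\sigma$ over all $\sigma\in S_n$ that preserve each column of $\lambda$, and let $S_n$ act on $\mathbb{C}[S_n]\,c$ by left multiplication. The normalized character is $$\Sigma^\lambda(\pi)=n(n-1)\cdots(n-l+1)\,\frac{\operatorname{Tr}\rho^\lambda(\pi)}{\operatorname{Tr}\rho^\lambda(e)}.$$ Then $$\Sigma^\lambda(\pi)=\sum_{\substack{\sigma_1,\sigma_2\in S_l\\ \sigma_1\sigma_2=\pi}}(-1)^{|\sigma_1|}\,N^\lambda(\sigma_1,\sigma_2).$$ Here $|\sigma|$ is the minimal number of factors necessary to write $\sigma$ as a product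 of transpositions, and $N^\lambda(\sigma_1,\sigma_2)$ is the number of functions $h\colon C(\sigma_1)\sqcup C(\sigma_2)\to\mathbb{N}$, where $C(\sigma)$ denotes the set of cycles of $\sigma$ (fixed points included), that are compatible with $\lambda$: for all $c_1\in C(\sigma_1)$ and $c_2\in C(\sigma_2)$ with $c_1\cap c_2\ne\emptyset$, $0<h(c_1)\le\lambda_{h(c_2)}$ holds, i.e. $\lambda$ has a box in column $h(c_1)$ and row $h(c_2)$ (rows and columns numbered from $1$). -/

import Mathlib

namespace StanleyFeray

open Equiv

/-! ### The irreducible representation `ρ^lam`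

Boxes of a `YoungDiagram` are pairs `(row, column)`, both numbered from `0`.  A bijection
`T : Fin n ≃ {b // b ∈ lam.cells}` is a Young tableau: `T i` is the box that contains `i`. -/

/-- `σ` preserves each row of the tableau `T`. -/
def PreservesRows {n : ℕ} {lam : YoungDiagram} (T : Fin n ≃ {b // b ∈ lam.cells})
    (σ : Perm (Fin n)) : Prop :=
  ∀ i, (T (σ i)).1.1 = (T i).1.1

/-- `σ` preserves each column of the tableau `T`. -/
def PreservesColumns {n : ℕ} {lam : YoungDiagram} (T : Fin n ≃ {b // b ∈ lam.cells})
    (σ : Perm (Fin n)) : Prop :=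
  ∀ i, (T (σ i)).1.2 = (T i).1.2

open Classical in
/-- The row symmetrizer `a_T`, the sum of all permutations that preserve each row. -/
noncomputable def rowSymmetrizer {n : ℕ} {lam : YoungDiagram}
    (T : Fin n ≃ {b // b ∈ lam.cells}) : MonoidAlgebra ℂ (Perm (Fin n)) :=
  ∑ σ : Perm (Fin n) with PreservesRows T σ, MonoidAlgebra.single σ (1 : ℂ)

open Classical in
/-- The column antisymmetrizer `b_T`, the signed sum of all permutations that preserve each
column. -/
noncomputable def columnAntisymmetrizer {n : ℕ} {lam : YoungDiagram}
    (T : Fin n ≃ {b // b ∈ lam.cells}) : MonoidAlgebra ℂ (Perm (Fin n)) :=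
  ∑ σ : Perm (Fin n) with PreservesColumns T σ,
    MonoidAlgebra.single σ (((Perm.sign σ : ℤˣ) : ℤ) : ℂ)

/-- The Young symmetrizer `c_T = b_T a_T`. -/
noncomputable def youngSymmetrizer {n : ℕ} {lam : YoungDiagram}
    (T : Fin n ≃ {b // b ∈ lam.cells}) : MonoidAlgebra ℂ (Perm (Fin n)) :=
  columnAntisymmetrizer T * rowSymmetrizer T

/-- The left ideal `ℂ[S_n] c_T` of the group algebra. -/
noncomputable def youngModule {n : ℕ} {lam : YoungDiagram}
    (T : Fin n ≃ {b // b ∈ lam.cells}) : Ideal (MonoidAlgebra ℂ (Perm (Fin n))) :=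
  Ideal.span {youngSymmetrizer T}

/-- The representation `ρ^lam` of `S_n`: the symmetric group acts on `ℂ[S_n] c_T` by left
multiplication.  (Up to isomorphism it depends only on the shape `lam` of `T`.) -/
noncomputable def youngRepresentation {n : ℕ} {lam : YoungDiagram}
    (T : Fin n ≃ {b // b ∈ lam.cells}) : Representation ℂ (Perm (Fin n)) (youngModule T) :=
  Representation.ofModule' (youngModule T)

/-- The character of `ρ^lam`, rescaled so that its value at the identity is `1`. -/
noncomputable def rescaledCharacter {n : ℕ} {lam : YoungDiagram}
    (T : Fin n ≃ {b // b ∈ lam.cells}) (π : Perm (Fin n)) : ℂ :=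
  LinearMap.trace ℂ (youngModule T) (youngRepresentation T π) /
    LinearMap.trace ℂ (youngModule T) (youngRepresentation T 1)

/-- The normalized character `Σ^lam(π) = (n)_l χ^lam(π)` for `π ∈ S_l`, `l ≤ n`, where `π` is
regarded as an element of `S_n` that fixes the points outside the first `l`. -/
noncomputable def normalizedCharacter {n : ℕ} {lam : YoungDiagram}
    (T : Fin n ≃ {b // b ∈ lam.cells}) {l : ℕ} (hl : l ≤ n) (π : Perm (Fin l)) : ℂ :=
  (n.descFactorial l : ℂ) * rescaledCharacter T (π.viaEmbedding (Fin.castLEEmb hl))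

/-! ### Colorings of cycles -/

/-- `|σ|`: the minimal number of factors necessary to write `σ` as a product of
transpositions. -/
noncomputable def absLength {l : ℕ} (σ : Perm (Fin l)) : ℕ :=
  sInf {k : ℕ | ∃ L : List (Perm (Fin l)), L.length = k ∧ (∀ τ ∈ L, τ.IsSwap) ∧ L.prod = σ}

/-- The set `C(σ)` of cycles of `σ`, fixed points included. -/
abbrev Cycles {l : ℕ} (σ : Perm (Fin l)) : Type :=
  Quotient (Perm.SameCycle.setoid σ)

/-- The cycle of `σ` that contains `m`. -/
def cycleOfPoint {l : ℕ} (σ : Perm (Fin l)) (m : Fin l) : Cycles σ :=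
  Quotient.mk (Perm.SameCycle.setoid σ) m

/-- A coloring `h` of the cycles of `σ₁` (by columns) and of `σ₂` (by rows) is compatible with
`lam` if for all cycles `c₁` of `σ₁` and `c₂` of `σ₂` with a common point the box in column
`h c₁` and row `h c₂` belongs to `lam`. -/
def IsCompatible {l : ℕ} (lam : YoungDiagram) (σ₁ σ₂ : Perm (Fin l))
    (h : Cycles σ₁ ⊕ Cycles σ₂ → ℕ) : Prop :=
  ∀ (c₁ : Cycles σ₁) (c₂ : Cycles σ₂),
    (∃ m : Fin l, cycleOfPoint σ₁ m = c₁ ∧ cycleOfPoint σ₂ m = c₂) →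
      (h (Sum.inr c₂), h (Sum.inl c₁)) ∈ lam

/-- `N^lam(σ₁, σ₂)`: the number of colorings compatible with `lam`.  (There are finitely many,
since every cycle meets a cycle of the other permutation.) -/
noncomputable def numColorings {l : ℕ} (lam : YoungDiagram) (σ₁ σ₂ : Perm (Fin l)) : ℕ :=
  Set.ncard {h : Cycles σ₁ ⊕ Cycles σ₂ → ℕ | IsCompatible lam σ₁ σ₂ h}

end StanleyFeray

namespace StanleyFeray

open Equiv Finset

/-! ### Traces in the group algebra -/

/-! The Young symmetrizer `c` satisfies `c² = αc` with `α ≠ 0`, so right multiplication by `α⁻¹c`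
projects the group algebra onto the left ideal, and the trace of `π` becomes a sum of coefficients
of `c` over conjugates. The unknown `α` cancels in the ratio, leaving the average over `g` of the
coefficient of `c` at `gπg⁻¹` (`rescaledCharacter_eq_sum`).

That coefficient counts, with sign, the factorizations of `gπg⁻¹` into a column- and a
row-preserving factor; these descend to factorizations `σ₁σ₂ = π` in `S_l` preserving the filling of
the `l` points by boxes. The factor `(n)_l` turns the average into a sum over injective fillings,
and noninjective ones contribute zero, so all fillings may be included. Exchanging the sums leaves,
for each `σ₁σ₂ = π`, the number of preserved fillings, which is the number of compatible colorings.
-/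

theorem trace_mulLeft_single_comp_mulRight {G : Type*} [Group G] [Fintype G]
    (g : G) (y : MonoidAlgebra ℂ G) :
    LinearMap.trace ℂ (MonoidAlgebra ℂ G)
        (LinearMap.mulLeft ℂ (MonoidAlgebra.single g 1) ∘ₗ LinearMap.mulRight ℂ y) =
      ∑ x : G, y.coeff (x⁻¹ * g⁻¹ * x) := by
  classical
  rw [LinearMap.trace_eq_matrix_trace ℂ (MonoidAlgebra.basis G ℂ), Matrix.trace]
  refine Finset.sum_congr rfl fun x _ => ?_
  have : (MonoidAlgebra.basis G ℂ).repr
      (MonoidAlgebra.single g 1 * (MonoidAlgebra.single x 1 * y)) x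
      = (MonoidAlgebra.single g 1 * (MonoidAlgebra.single x 1 * y)).coeff x := rfl
  rw [Matrix.diag_apply, LinearMap.toMatrix_apply]
  simp only [LinearMap.comp_apply, LinearMap.mulLeft_apply, LinearMap.mulRight_apply,
    MonoidAlgebra.basis_apply]
  rw [this, ← mul_assoc, MonoidAlgebra.single_mul_single, MonoidAlgebra.coeff_single_mul_apply]
  simp [mul_assoc]

/-! ### Combinatorics of Young diagrams -/

/-- Induction on columns. If `(r, k)` were in `A` but not in `lam`, row `r` of `lam` would lie in
columns before `k`, where the two sets agree, so row `r` of `A` would be strictly larger. Hence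
column `k` of `A` lies in that of `lam`, and equal cardinality finishes. -/
theorem eq_cells_of_card_row_eq_of_card_col_eq (lam : YoungDiagram) (A : Finset (ℕ × ℕ))
    (hr : ∀ r, #{b ∈ A | b.1 = r} = #{b ∈ lam.cells | b.1 = r})
    (hc : ∀ k, #{b ∈ A | b.2 = k} = #{b ∈ lam.cells | b.2 = k}) : A = lam.cells := by
  suffices h : ∀ k r, (r, k) ∈ A ↔ (r, k) ∈ lam.cells by
    ext ⟨r, k⟩; exact h k r
  intro k
  induction k using Nat.strong_induction_on with
  | _ k ih =>
  have hsub : ∀ r, (r, k) ∈ A → (r, k) ∈ lam.cells := by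
    intro r hrk
    by_contra hn
    have hs : {b ∈ lam.cells | b.1 = r} ⊆ {b ∈ A | b.1 = r} := by
      rintro ⟨r', j⟩ hb
      simp only [Finset.mem_filter] at hb ⊢
      obtain ⟨hb, rfl⟩ := hb
      refine ⟨(ih j ?_ _).2 hb, rfl⟩
      by_contra hj
      exact hn (lam.up_left_mem le_rfl (not_lt.1 hj) hb)
    have he := Finset.eq_of_subset_of_card_le hs (hr r).le
    have hmem : (r, k) ∈ ({b ∈ lam.cells | b.1 = r} : Finset _) := by
      rw [he]; simpa using hrk
    exact hn (Finset.mem_filter.1 hmem).1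
  have hs : {b ∈ A | b.2 = k} ⊆ {b ∈ lam.cells | b.2 = k} := by
    rintro ⟨r, j⟩ hb
    simp only [Finset.mem_filter] at hb ⊢
    obtain ⟨hb, rfl⟩ := hb
    exact ⟨hsub r hb, rfl⟩
  have he := Finset.eq_of_subset_of_card_le hs (hc k).ge
  intro r
  have := Finset.ext_iff.1 he (r, k)
  simpa using this

section Tableau

variable {n : ℕ} {lam : YoungDiagram} (T : Fin n ≃ {b // b ∈ lam.cells})

theorem box_ext {x y : Fin n} (h1 : (T x).1.1 = (T y).1.1) (h2 : (T x).1.2 = (T y).1.2) :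
    x = y :=
  T.injective (Subtype.ext (Prod.ext h1 h2))

theorem card_filter_tableau (P : ℕ × ℕ → Prop) [DecidablePred P] :
    #{i : Fin n | P (T i).1} = #{b ∈ lam.cells | P b} := by
  refine Finset.card_bij (fun i _ => (T i).1) ?_ ?_ ?_
  · intro i hi
    simp only [Finset.mem_filter, Finset.mem_univ, true_and] at hi ⊢
    exact ⟨(T i).2, hi⟩
  · intro i _ j _ h
    exact T.injective (Subtype.ext h)
  · intro b hb
    simp only [Finset.mem_filter, Finset.mem_univ, true_and] at hb ⊢
    exact ⟨T.symm ⟨b, hb.1⟩, by simpa using hb.2, by simp⟩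

/-- If no two entries in a common row are moved to a common column, then `g` is the product of a
column-preserving and a row-preserving permutation. -/
theorem exists_mul_eq_of_forall_ne (g : Perm (Fin n))
    (hg : ∀ i j, (T i).1.1 = (T j).1.1 → (T (g i)).1.2 = (T (g j)).1.2 → i = j) :
    ∃ q p, PreservesColumns T q ∧ PreservesRows T p ∧ g = q * p := by
  classical
  -- In `g = q * p` the box of `p i` is forced: its row is that of `i`, its column that of `g i`.
  let f : Fin n → ℕ × ℕ := fun i => ((T i).1.1, (T (g i)).1.2)
  have hf : Function.Injective f := fun i j h => hg i j (Prod.ext_iff.1 h).1 (Prod.ext_iff.1 h).2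
  have hA : (Finset.univ.image f) = lam.cells := by
    apply eq_cells_of_card_row_eq_of_card_col_eq
    · intro r
      rw [Finset.filter_image, Finset.card_image_of_injective _ hf]
      exact card_filter_tableau T (fun b => b.1 = r)
    · intro k
      rw [Finset.filter_image, Finset.card_image_of_injective _ hf]
      rw [← card_filter_tableau T (fun b => b.2 = k)]
      exact Finset.card_equiv g (by simp [f])
  have hmem : ∀ i, f i ∈ lam.cells := fun i => hA ▸ Finset.mem_image_of_mem f (Finset.mem_univ i)
  let p' : Fin n → Fin n := fun i => T.symm ⟨f i, hmem i⟩
  have hp' : ∀ i, (T (p' i)).1 = f i := fun i => by simp [p']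
  have hinj : Function.Injective p' := fun i j h => hf (by rw [← hp', ← hp', h])
  let p : Perm (Fin n) := Equiv.ofBijective p' (Finite.injective_iff_bijective.1 hinj)
  have hp : ∀ i, (T (p i)).1 = f i := hp'
  refine ⟨g * p⁻¹, p, ?_, ?_, by simp⟩
  · intro i
    obtain ⟨j, rfl⟩ := p.surjective i
    rw [hp]; simp [f]
  · intro i
    rw [hp]

/-! ### The Young symmetrizer -/

variable {T}

theorem PreservesRows.mul {σ τ : Perm (Fin n)} (hσ : PreservesRows T σ) (hτ : PreservesRows T τ) :
    PreservesRows T (σ * τ) := fun i => (hσ (τ i)).trans (hτ i)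

theorem PreservesRows.inv {σ : Perm (Fin n)} (hσ : PreservesRows T σ) :
    PreservesRows T σ⁻¹ := fun i => by simpa using (hσ (σ⁻¹ i)).symm

theorem PreservesColumns.mul {σ τ : Perm (Fin n)} (hσ : PreservesColumns T σ)
    (hτ : PreservesColumns T τ) : PreservesColumns T (σ * τ) :=
  fun i => (hσ (τ i)).trans (hτ i)

theorem PreservesColumns.inv {σ : Perm (Fin n)} (hσ : PreservesColumns T σ) :
    PreservesColumns T σ⁻¹ := fun i => by simpa using (hσ (σ⁻¹ i)).symm

theorem single_mul_rowSymmetrizer {p : Perm (Fin n)} (hp : PreservesRows T p) :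
    MonoidAlgebra.single p (1 : ℂ) * rowSymmetrizer T = rowSymmetrizer T := by
  classical
  rw [rowSymmetrizer, Finset.mul_sum]
  refine Finset.sum_bij' (fun σ _ => p * σ) (fun σ _ => p⁻¹ * σ) ?_ ?_ ?_ ?_ ?_
  · intro σ hσ
    simp only [Finset.mem_filter, Finset.mem_univ, true_and] at hσ ⊢
    exact hp.mul hσ
  · intro σ hσ
    simp only [Finset.mem_filter, Finset.mem_univ, true_and] at hσ ⊢
    exact hp.inv.mul hσ
  · simp
  · simp
  · intro σ _
    rw [MonoidAlgebra.single_mul_single, one_mul]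

theorem columnAntisymmetrizer_mul_single {q : Perm (Fin n)} (hq : PreservesColumns T q) :
    columnAntisymmetrizer T * MonoidAlgebra.single q (1 : ℂ) =
      (((Perm.sign q : ℤˣ) : ℤ) : ℂ) • columnAntisymmetrizer T := by
  classical
  rw [columnAntisymmetrizer, Finset.sum_mul, Finset.smul_sum]
  refine Finset.sum_bij' (fun σ _ => σ * q) (fun σ _ => σ * q⁻¹) ?_ ?_ ?_ ?_ ?_
  · intro σ hσ
    simp only [Finset.mem_filter, Finset.mem_univ, true_and] at hσ ⊢
    exact hσ.mul hq
  · intro σ hσ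
    simp only [Finset.mem_filter, Finset.mem_univ, true_and] at hσ ⊢
    exact hσ.mul hq.inv
  · simp
  · simp
  · intro σ _
    rw [MonoidAlgebra.single_mul_single, MonoidAlgebra.smul_single, Perm.sign_mul]
    congr 1
    rcases Int.units_eq_one_or (Perm.sign q) with h | h <;> simp [h]

theorem preservesRows_swap {i j : Fin n} (h : (T i).1.1 = (T j).1.1) :
    PreservesRows T (swap i j) := by
  intro m
  rw [Equiv.swap_apply_def]; split_ifs with h1 h2 <;> simp_all

theorem preservesColumns_swap {i j : Fin n} (h : (T i).1.2 = (T j).1.2) :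
    PreservesColumns T (swap i j) := by
  intro m
  rw [Equiv.swap_apply_def]; split_ifs with h1 h2 <;> simp_all

variable (T)

/-- By linearity take `x = g`. Either `g = q * p` and both factors are absorbed up to sign, or `g`
carries a swap within a row to a swap within a column, which makes the product equal to its own
negative. -/
theorem exists_columnAntisymmetrizer_mul_mul_rowSymmetrizer (x : MonoidAlgebra ℂ (Perm (Fin n))) :
    ∃ β : ℂ, columnAntisymmetrizer T * x * rowSymmetrizer T = β • youngSymmetrizer T := by
  induction x using MonoidAlgebra.induction_linear with
  | zero => exact ⟨0, by simp⟩
  | add x y hx hy =>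
    obtain ⟨α, hα⟩ := hx
    obtain ⟨β, hβ⟩ := hy
    exact ⟨α + β, by rw [mul_add, add_mul, hα, hβ, add_smul]⟩
  | single g r =>
    suffices h : ∃ β : ℂ, columnAntisymmetrizer T * MonoidAlgebra.single g 1 * rowSymmetrizer T =
        β • youngSymmetrizer T by
      obtain ⟨β, hβ⟩ := h
      refine ⟨r * β, ?_⟩
      rw [mul_smul, ← hβ, ← smul_mul_assoc, ← mul_smul_comm, MonoidAlgebra.smul_single,
        smul_eq_mul, mul_one]
    by_cases hg : ∀ i j, (T i).1.1 = (T j).1.1 → (T (g i)).1.2 = (T (g j)).1.2 → i = j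
    · obtain ⟨q, p, hq, hp, rfl⟩ := exists_mul_eq_of_forall_ne T g hg
      refine ⟨(((Perm.sign q : ℤˣ) : ℤ) : ℂ), ?_⟩
      rw [← one_mul (1 : ℂ), ← MonoidAlgebra.single_mul_single, ← mul_assoc, mul_assoc,
        single_mul_rowSymmetrizer hp, columnAntisymmetrizer_mul_single hq, smul_mul_assoc]
      rfl
    · push Not at hg
      obtain ⟨i, j, hrow, hcol, hij⟩ := hg
      refine ⟨0, ?_⟩
      have hs : MonoidAlgebra.single g (1 : ℂ) * MonoidAlgebra.single (swap i j) 1 =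
          MonoidAlgebra.single (swap (g i) (g j)) 1 * MonoidAlgebra.single g 1 := by
        rw [MonoidAlgebra.single_mul_single, MonoidAlgebra.single_mul_single,
          Equiv.mul_swap_eq_swap_mul]
      have key : columnAntisymmetrizer T * MonoidAlgebra.single g 1 * rowSymmetrizer T =
          -(columnAntisymmetrizer T * MonoidAlgebra.single g 1 * rowSymmetrizer T) := by
        conv_lhs => rw [← single_mul_rowSymmetrizer (preservesRows_swap hrow), ← mul_assoc,
          mul_assoc (columnAntisymmetrizer T), hs, ← mul_assoc,
          columnAntisymmetrizer_mul_single (preservesColumns_swap hcol),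
          Perm.sign_swap (fun h => hij (g.injective h))]
        simp
      rw [zero_smul]
      have h2 : (2 : ℂ) •
          (columnAntisymmetrizer T * MonoidAlgebra.single g 1 * rowSymmetrizer T) = 0 := by
        rw [two_smul]
        nth_rw 1 [key]
        exact neg_add_cancel _
      rw [← inv_smul_smul₀ (two_ne_zero' ℂ)
        (columnAntisymmetrizer T * MonoidAlgebra.single g 1 * rowSymmetrizer T), h2, smul_zero]

theorem exists_youngSymmetrizer_mul_self :
    ∃ α : ℂ, youngSymmetrizer T * youngSymmetrizer T = α • youngSymmetrizer T := by
  obtain ⟨α, hα⟩ := exists_columnAntisymmetrizer_mul_mul_rowSymmetrizer T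
    (rowSymmetrizer T * columnAntisymmetrizer T)
  exact ⟨α, by rw [← hα]; simp only [youngSymmetrizer, mul_assoc]⟩

open Classical in
theorem coeff_youngSymmetrizer (g : Perm (Fin n)) :
    (youngSymmetrizer T).coeff g =
      ∑ p : Perm (Fin n) × Perm (Fin n) with
        p.1 * p.2 = g ∧ PreservesColumns T p.1 ∧ PreservesRows T p.2,
        (((Perm.sign p.1 : ℤˣ) : ℤ) : ℂ) := by
  rw [youngSymmetrizer, columnAntisymmetrizer, rowSymmetrizer, Finset.sum_mul_sum,
    ← Finset.sum_product']
  simp only [MonoidAlgebra.single_mul_single, mul_one, MonoidAlgebra.coeff_sum,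
    Finsupp.finsetSum_apply, MonoidAlgebra.coeff_single, Finsupp.single_apply]
  rw [← Finset.sum_filter]
  refine Finset.sum_congr ?_ fun _ _ => rfl
  ext p
  simp only [Finset.mem_filter, Finset.mem_product, Finset.mem_univ, true_and]
  tauto

theorem coeff_one_youngSymmetrizer : (youngSymmetrizer T).coeff 1 = 1 := by
  classical
  rw [coeff_youngSymmetrizer, Finset.sum_eq_single (1, 1)]
  · simp
  · rintro ⟨q, p⟩ h hne
    exfalso
    apply hne
    simp only [Finset.mem_filter, Finset.mem_univ, true_and] at h
    obtain ⟨hqp, hq, hp⟩ := h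
    have hq' := eq_inv_of_mul_eq_one_left hqp
    have hq1 : q = 1 := by
      ext1 i
      exact box_ext T ((hq' ▸ hp.inv : PreservesRows T q) i) (hq i)
    subst hq1
    simpa using hqp
  · intro h
    refine (h (Finset.mem_filter.2 ⟨Finset.mem_univ _, mul_one _, ?_, ?_⟩)).elim <;>
    exact fun _ => rfl

/-! ### The character -/

/-- The map `r` is a retraction of the inclusion `i`, so cyclicity of the trace moves the
computation to the whole group algebra. -/
theorem trace_youngRepresentation {α : ℂ} (hα : α ≠ 0)
    (h : youngSymmetrizer T * youngSymmetrizer T = α • youngSymmetrizer T) (π : Perm (Fin n)) :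
    LinearMap.trace ℂ (youngModule T) (youngRepresentation T π) =
      α⁻¹ * ∑ g : Perm (Fin n), (youngSymmetrizer T).coeff (g⁻¹ * π⁻¹ * g) := by
  set c := youngSymmetrizer T
  let i : youngModule T →ₗ[ℂ] MonoidAlgebra ℂ (Perm (Fin n)) :=
    (youngModule T).subtype.restrictScalars ℂ
  let r : MonoidAlgebra ℂ (Perm (Fin n)) →ₗ[ℂ] youngModule T :=
    { toFun := fun x => ⟨x * α⁻¹ • c, by
        rw [mul_smul_comm, ← smul_mul_assoc]
        exact Ideal.mul_mem_left _ _ (Ideal.subset_span rfl)⟩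
      map_add' := fun x y => Subtype.ext (by simp [add_mul])
      map_smul' := fun a x => Subtype.ext (by simp [smul_comm a]) }
  have hri : r ∘ₗ i = LinearMap.id := by
    ext ⟨x, hx⟩ : 2
    obtain ⟨y, rfl⟩ := Ideal.mem_span_singleton'.1 hx
    change (y * c) * α⁻¹ • c = y * c
    rw [mul_smul_comm, mul_assoc, h, mul_smul_comm, smul_smul, inv_mul_cancel₀ hα, one_smul]
  have hcomp : i ∘ₗ (youngRepresentation T π ∘ₗ r) =
      α⁻¹ • (LinearMap.mulLeft ℂ (MonoidAlgebra.single π 1) ∘ₗ LinearMap.mulRight ℂ c) := by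
    refine LinearMap.ext fun x => ?_
    have : i ((youngRepresentation T π) (r x)) =
        MonoidAlgebra.single π 1 * (x * α⁻¹ • c) := by
      simp [youngRepresentation, Representation.ofModule', i, r]
    simp [this]
  have : youngRepresentation T π = (youngRepresentation T π ∘ₗ r) ∘ₗ i := by
    rw [LinearMap.comp_assoc, hri, LinearMap.comp_id]
  rw [this, LinearMap.trace_comp_comm', hcomp, map_smul, trace_mulLeft_single_comp_mulRight,
    smul_eq_mul]

/-- If `α = 0`, right multiplication by `c` is nilpotent and has trace `0`; but its trace is `n!`
times the coefficient of `c` at `1`, that is `n!`. -/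
theorem ne_zero_of_youngSymmetrizer_mul_self {α : ℂ}
    (h : youngSymmetrizer T * youngSymmetrizer T = α • youngSymmetrizer T) : α ≠ 0 := by
  rintro rfl
  have htr := trace_mulLeft_single_comp_mulRight (1 : Perm (Fin n)) (youngSymmetrizer T)
  have h1 : LinearMap.mulLeft ℂ (MonoidAlgebra.single (1 : Perm (Fin n)) (1 : ℂ)) =
      LinearMap.id := by
    ext1; simp [← MonoidAlgebra.one_def]
  rw [h1, LinearMap.id_comp, (LinearMap.isNilpotent_trace_of_isNilpotent ?_).eq_zero] at htr
  · simp only [inv_one, mul_one, inv_mul_cancel, coeff_one_youngSymmetrizer] at htr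
    simp only [Finset.sum_const, Finset.card_univ, Fintype.card_perm, Fintype.card_fin,
      nsmul_eq_mul, mul_one] at htr
    exact Nat.cast_ne_zero.2 n.factorial_ne_zero htr.symm
  · refine ⟨2, LinearMap.ext fun x => ?_⟩
    simp [pow_two, mul_assoc, h]

theorem rescaledCharacter_eq_sum (π : Perm (Fin n)) :
    rescaledCharacter T π =
      (n.factorial : ℂ)⁻¹ * ∑ g : Perm (Fin n), (youngSymmetrizer T).coeff (g * π * g⁻¹) := by
  obtain ⟨α, h⟩ := exists_youngSymmetrizer_mul_self T
  have hα := ne_zero_of_youngSymmetrizer_mul_self T h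
  rw [rescaledCharacter, trace_youngRepresentation T hα h, trace_youngRepresentation T hα h,
    mul_div_mul_left _ _ (inv_ne_zero hα), div_eq_inv_mul]
  congr 1
  · simp [coeff_one_youngSymmetrizer, Fintype.card_perm]
  -- Since `k * π * k⁻¹ = π⁻¹`, the substitution `g ↦ g⁻¹ * k` removes the inverse on `π`.
  · obtain ⟨k, hk⟩ := isConj_iff.1 (Perm.isConj_iff_cycleType_eq.2 (Perm.cycleType_inv π).symm)
    refine Fintype.sum_equiv ((Equiv.inv _).trans (Equiv.mulRight k)) _ _ fun g => ?_
    congr 1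
    simp only [← hk]
    simp [mul_assoc]

end Tableau

/-! ### Signs -/

theorem neg_one_pow_absLength {l : ℕ} (σ : Perm (Fin l)) :
    (-1 : ℂ) ^ absLength σ = (((Perm.sign σ : ℤˣ) : ℤ) : ℂ) := by
  -- Nonemptiness ensures that the infimum is attained rather than the default `0`.
  have hne : {k : ℕ | ∃ L : List (Perm (Fin l)),
      L.length = k ∧ (∀ τ ∈ L, τ.IsSwap) ∧ L.prod = σ}.Nonempty := by
    obtain ⟨L, hL, hs⟩ := Perm.swapFactors σ
    exact ⟨L.length, L, rfl, hs, hL⟩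
  obtain ⟨L, hlen, hs, hprod⟩ := Nat.sInf_mem hne
  rw [absLength, ← hlen, ← hprod, Perm.sign_prod_list_swap hs]
  simp

/-! ### Factorizations compatible with a map into the boxes -/

/-- `σ₁` preserves the columns and `σ₂` preserves the rows of the filling `f`. -/
def PreservesFilling {l : ℕ} (f : Fin l → ℕ × ℕ) (σ₁ σ₂ : Perm (Fin l)) : Prop :=
  (∀ m, (f (σ₁ m)).2 = (f m).2) ∧ ∀ m, (f (σ₂ m)).1 = (f m).1

open Classical in
/-- The signed number of factorizations of `π` that preserve the filling `f`. -/
noncomputable def signedFactorizations {l : ℕ} (π : Perm (Fin l)) (f : Fin l → ℕ × ℕ) : ℂ :=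
  ∑ p : Perm (Fin l) × Perm (Fin l) with p.1 * p.2 = π ∧ PreservesFilling f p.1 p.2,
    (((Perm.sign p.1 : ℤˣ) : ℤ) : ℂ)

/-- If `i ≠ j` lie in the same box, inserting `swap i j` twice between the factors is a
sign-reversing involution. -/
theorem signedFactorizations_eq_zero_of_not_injective {l : ℕ} (π : Perm (Fin l))
    (f : Fin l → ℕ × ℕ) (hf : ¬ Function.Injective f) : signedFactorizations π f = 0 := by
  classical
  simp only [Function.Injective, not_forall] at hf
  obtain ⟨i, j, hfij, hij⟩ := hf
  have hs : ∀ m, f (swap i j m) = f m := by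
    intro m
    rw [Equiv.swap_apply_def]; split_ifs with h1 h2 <;> simp_all
  refine Finset.sum_involution (fun p _ => (p.1 * swap i j, swap i j * p.2)) ?_ ?_ ?_ ?_
  · intro p _
    simp [Perm.sign_mul, Perm.sign_swap hij]
  · intro p _ _ h
    have : p.1 * swap i j = p.1 := congrArg Prod.fst h
    exact hij (Equiv.swap_eq_one_iff.1 (by simpa using this))
  · rintro ⟨s, t⟩ h
    simp only [Finset.mem_filter, Finset.mem_univ, true_and] at h ⊢
    obtain ⟨h1, h2, h3⟩ := h
    refine ⟨?_, fun m => ?_, fun m => ?_⟩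
    · rw [mul_assoc, Equiv.swap_mul_self_mul, h1]
    · rw [Perm.mul_apply, h2, hs]
    · rw [Perm.mul_apply, hs, h3]
  · rintro ⟨s, t⟩ _
    simp

theorem exists_viaEmbedding_eq {α β : Type*} [Finite α] (ι : α ↪ β) (s : Perm β)
    (hs : ∀ x, x ∉ Set.range ι → s x = x) : ∃ σ : Perm α, σ.viaEmbedding ι = s := by
  have hr : ∀ m, s (ι m) ∈ Set.range ι := by
    intro m
    by_contra h
    exact h ⟨m, (s.injective (hs _ h)).symm⟩
  choose σ hσ using hr
  have hinj : Function.Injective σ := fun x y h =>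
    ι.injective (s.injective (by rw [← hσ, ← hσ, h]))
  refine ⟨Equiv.ofBijective σ (Finite.injective_iff_bijective.1 hinj), ?_⟩
  ext x
  by_cases hx : x ∈ Set.range ι
  · obtain ⟨m, rfl⟩ := hx
    rw [Perm.viaEmbedding_apply]
    exact hσ m
  · rw [Perm.viaEmbedding_apply_of_notMem _ _ _ hx, hs x hx]

theorem viaEmbedding_mul {α β : Type*} (ι : α ↪ β) (σ τ : Perm α) :
    (σ * τ).viaEmbedding ι = σ.viaEmbedding ι * τ.viaEmbedding ι :=
  map_mul (Perm.viaEmbeddingHom ι) σ τ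

theorem sign_viaEmbedding {l n : ℕ} (ι : Fin l ↪ Fin n) (σ : Perm (Fin l)) :
    Perm.sign (σ.viaEmbedding ι) = Perm.sign σ := by
  classical
  rw [Perm.viaEmbedding]
  convert Perm.sign_extendDomain σ (Equiv.ofInjective ι.toFun ι.injective)

variable {n : ℕ} {lam : YoungDiagram} (T : Fin n ≃ {b // b ∈ lam.cells})

/-- Only the entries in the image of `ι` matter: in a factorization of a permutation fixing the
other entries, both factors fix them too. -/
theorem coeff_youngSymmetrizer_conj_viaEmbedding {l : ℕ} (ι : Fin l ↪ Fin n) (π : Perm (Fin l))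
    (g : Perm (Fin n)) :
    (youngSymmetrizer T).coeff (g * π.viaEmbedding ι * g⁻¹) =
      signedFactorizations π (fun m => (T (g (ι m))).1) := by
  classical
  rw [coeff_youngSymmetrizer, signedFactorizations]
  symm
  have hcol : ∀ σ : Perm (Fin l), PreservesColumns T (g * σ.viaEmbedding ι * g⁻¹) ↔
      ∀ m, (T (g (ι (σ m)))).1.2 = (T (g (ι m))).1.2 := by
    intro σ
    constructor
    · intro h m
      simpa [Perm.viaEmbedding_apply] using h (g (ι m))
    · intro h x
      obtain ⟨x, rfl⟩ := g.surjective x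
      by_cases hx : x ∈ Set.range ι
      · obtain ⟨m, rfl⟩ := hx
        simpa [Perm.viaEmbedding_apply] using h m
      · simp [Perm.viaEmbedding_apply_of_notMem _ _ _ hx]
  have hrow : ∀ σ : Perm (Fin l), PreservesRows T (g * σ.viaEmbedding ι * g⁻¹) ↔
      ∀ m, (T (g (ι (σ m)))).1.1 = (T (g (ι m))).1.1 := by
    intro σ
    constructor
    · intro h m
      simpa [Perm.viaEmbedding_apply] using h (g (ι m))
    · intro h x
      obtain ⟨x, rfl⟩ := g.surjective x
      by_cases hx : x ∈ Set.range ι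
      · obtain ⟨m, rfl⟩ := hx
        simpa [Perm.viaEmbedding_apply] using h m
      · simp [Perm.viaEmbedding_apply_of_notMem _ _ _ hx]
  have hinj : Function.Injective fun σ : Perm (Fin l) => σ.viaEmbedding ι :=
    Perm.viaEmbeddingHom_injective ι
  refine Finset.sum_bij (fun p _ => (g * p.1.viaEmbedding ι * g⁻¹, g * p.2.viaEmbedding ι * g⁻¹))
    ?_ ?_ ?_ ?_
  · rintro ⟨σ, τ⟩ h
    simp only [Finset.mem_filter, Finset.mem_univ, true_and] at h ⊢
    obtain ⟨rfl, h1, h2⟩ := h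
    exact ⟨by rw [viaEmbedding_mul]; group, (hcol σ).2 h1, (hrow τ).2 h2⟩
  · rintro ⟨σ, τ⟩ _ ⟨σ', τ'⟩ _ h
    simp only [Prod.mk.injEq, mul_left_inj, mul_right_inj] at h
    exact Prod.ext (hinj h.1) (hinj h.2)
  · rintro ⟨q, p⟩ h
    simp only [Finset.mem_filter, Finset.mem_univ, true_and] at h
    obtain ⟨hqp, hq, hp⟩ := h
    -- Here `p` keeps the row of `g x`, and `q`, which brings `p (g x)` back to `g x`, keeps the
    -- column; so `p (g x)` and `g x` occupy the same box.
    have hfix : ∀ x, x ∉ Set.range ι → p (g x) = g x ∧ q (g x) = g x := by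
      intro x hx
      have h1 : q (p (g x)) = g x := by
        rw [← Perm.mul_apply, hqp]
        simp [Perm.viaEmbedding_apply_of_notMem _ _ _ hx]
      have h2 : p (g x) = g x := by
        apply box_ext T (hp _)
        rw [← hq (p (g x)), h1]
      exact ⟨h2, by rwa [h2] at h1⟩
    obtain ⟨σ, hσ⟩ := exists_viaEmbedding_eq ι (g⁻¹ * q * g) fun x hx => by
      simp [(hfix x hx).2]
    obtain ⟨τ, hτ⟩ := exists_viaEmbedding_eq ι (g⁻¹ * p * g) fun x hx => by
      simp [(hfix x hx).1]
    have hσ' : g * σ.viaEmbedding ι * g⁻¹ = q := by rw [hσ]; group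
    have hτ' : g * τ.viaEmbedding ι * g⁻¹ = p := by rw [hτ]; group
    refine ⟨(σ, τ), ?_, Prod.ext hσ' hτ'⟩
    simp only [Finset.mem_filter, Finset.mem_univ, true_and]
    refine ⟨hinj ?_, (hcol σ).1 (hσ' ▸ hq), (hrow τ).1 (hτ' ▸ hp)⟩
    have : g * (σ * τ).viaEmbedding ι * g⁻¹ = g * π.viaEmbedding ι * g⁻¹ := by
      rw [← hqp, ← hσ', ← hτ', viaEmbedding_mul]; group
    simpa using this
  · rintro ⟨σ, τ⟩ _
    rw [Perm.sign_mul, Perm.sign_mul, Perm.sign_inv, mul_right_comm, Int.units_mul_self, one_mul,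
      sign_viaEmbedding]

/-! ### Averaging over the symmetric group -/

/-- `S_n` acts transitively on embeddings, so the fibres of `g ↦ g • ι` are equinumerous. -/
theorem descFactorial_mul_sum_perm {l : ℕ} (ι : Fin l ↪ Fin n)
    (F : (Fin l ↪ Fin n) → ℂ) :
    (n.descFactorial l : ℂ) * ((n.factorial : ℂ)⁻¹ * ∑ g : Perm (Fin n), F (g • ι)) =
      ∑ f : Fin l ↪ Fin n, F f := by
  classical
  have htrans := Perm.isMultiplyPretransitive (Fin n) l
  have hfib : ∀ f : Fin l ↪ Fin n,
      #{g : Perm (Fin n) | g • ι = f} = #{g : Perm (Fin n) | g • ι = ι} := by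
    intro f
    obtain ⟨k, rfl⟩ := htrans.exists_smul_eq ι f
    refine Finset.card_equiv (Equiv.mulLeft k⁻¹) fun g => ?_
    simp [mul_smul, inv_smul_eq_iff]
  have hsum : ∀ H : (Fin l ↪ Fin n) → ℂ, ∑ g : Perm (Fin n), H (g • ι) =
      #{g : Perm (Fin n) | g • ι = ι} * ∑ f, H f := by
    intro H
    rw [← Finset.sum_fiberwise Finset.univ (fun g : Perm (Fin n) => g • ι), Finset.mul_sum]
    refine Finset.sum_congr rfl fun f _ => ?_
    rw [← hfib f, ← nsmul_eq_mul, ← Finset.sum_const]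
    refine Finset.sum_congr rfl fun g hg => ?_
    rw [(Finset.mem_filter.1 hg).2]
  -- The constant function yields the fibre size: `n!` equals it times `(n)_l`.
  have hone := hsum fun _ => 1
  simp only [Finset.sum_const, Finset.card_univ, Fintype.card_perm, Fintype.card_fin,
    Fintype.card_embedding_eq, nsmul_eq_mul, mul_one] at hone
  have hn : (n.factorial : ℂ) ≠ 0 := Nat.cast_ne_zero.2 n.factorial_ne_zero
  rw [hsum, ← mul_assoc, ← mul_assoc]
  have : (n.descFactorial l : ℂ) * (n.factorial : ℂ)⁻¹ *
      (#{g : Perm (Fin n) | g • ι = ι} : ℂ) = 1 := by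
    field_simp
    rw [hone, mul_comm]
  rw [this, one_mul]

theorem normalizedCharacter_eq_sum_embedding {l : ℕ} (hl : l ≤ n) (π : Perm (Fin l)) :
    normalizedCharacter T hl π =
      ∑ f : Fin l ↪ Fin n, signedFactorizations π fun m => (T (f m)).1 := by
  rw [← descFactorial_mul_sum_perm (Fin.castLEEmb hl), normalizedCharacter,
    rescaledCharacter_eq_sum]
  congr 2
  exact Finset.sum_congr rfl fun g _ => coeff_youngSymmetrizer_conj_viaEmbedding T _ π g

theorem normalizedCharacter_eq_sum {l : ℕ} (hl : l ≤ n) (π : Perm (Fin l)) :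
    normalizedCharacter T hl π =
      ∑ f : Fin l → {b // b ∈ lam.cells}, signedFactorizations π fun m => (f m).1 := by
  classical
  rw [normalizedCharacter_eq_sum_embedding]
  refine Finset.sum_of_injOn (fun f m => T (f m)) ?_ (fun _ _ => Finset.mem_coe.2 (mem_univ _)) ?_
    fun _ _ => rfl
  · intro f _ f' _ h
    ext1 m
    exact T.injective (congrFun h m)
  · intro f _ hf
    apply signedFactorizations_eq_zero_of_not_injective
    intro hinj
    refine hf ⟨⟨fun m => T.symm (f m), fun x y h => hinj ?_⟩, by simp, ?_⟩
    · exact congrArg Subtype.val (T.symm.injective h)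
    · funext m; exact T.apply_symm_apply _

/-! ### Colorings -/

theorem apply_eq_of_sameCycle {α γ : Type*} {σ : Perm α} {u : α → γ} (hu : ∀ m, u (σ m) = u m)
    {x y : α} (h : σ.SameCycle x y) : u x = u y := by
  obtain ⟨k, rfl⟩ := h
  induction k using Int.induction_on with
  | zero => simp
  | succ k ih => rw [ih, add_comm, zpow_add, zpow_one, Perm.mul_apply, hu]
  | pred k ih =>
    rw [ih, ← hu ((σ ^ (-(k : ℤ) - 1)) x), ← Perm.mul_apply, ← zpow_one_add]
    congr 3; ring

theorem cycleOfPoint_apply {l : ℕ} (σ : Perm (Fin l)) (m : Fin l) :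
    cycleOfPoint σ (σ m) = cycleOfPoint σ m :=
  Quotient.sound (s := Perm.SameCycle.setoid σ)
    (Perm.sameCycle_apply_left.2 (Perm.SameCycle.refl σ m))

open Classical in
-- Preservation means that the column of `f m` depends only on the `σ₁`-cycle of `m`, and its row
-- only on the `σ₂`-cycle. Cycles meeting at `m` receive the coordinates of the box `f m`, so
-- compatibility says exactly that `f` takes values in `lam`.
theorem card_preservesFilling_eq_numColorings {l : ℕ} (lam : YoungDiagram)
    (σ₁ σ₂ : Perm (Fin l)) :
    #{f : Fin l → {b // b ∈ lam.cells} | PreservesFilling (fun m => (f m).1) σ₁ σ₂} =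
      numColorings lam σ₁ σ₂ := by
  rw [numColorings, ← Set.ncard_coe_finset]
  symm
  refine Set.ncard_congr (fun h hh m => ⟨(h (Sum.inr (cycleOfPoint σ₂ m)),
    h (Sum.inl (cycleOfPoint σ₁ m))), hh _ _ ⟨m, rfl, rfl⟩⟩) ?_ ?_ ?_
  · intro h hh
    rw [Finset.mem_coe, Finset.mem_filter]
    exact ⟨Finset.mem_univ _, fun m => by simp only [cycleOfPoint_apply],
      fun m => by simp only [cycleOfPoint_apply]⟩
  · intro h h' hh hh' heq
    have key := fun m => Prod.ext_iff.1 (congrArg Subtype.val (congrFun heq m))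
    funext c
    rcases c with c | c
    · induction c using Quotient.inductionOn with
      | _ m => exact (key m).2
    · induction c using Quotient.inductionOn with
      | _ m => exact (key m).1
  · intro f hf
    simp only [Finset.coe_filter, Finset.mem_univ, true_and, Set.mem_ofPred_eq] at hf
    refine ⟨Sum.elim
      (Quotient.lift (fun m => (f m).1.2) fun _ _ h =>
        apply_eq_of_sameCycle (σ := σ₁) (u := fun m => (f m).1.2) hf.1 h)
      (Quotient.lift (fun m => (f m).1.1) fun _ _ h =>
        apply_eq_of_sameCycle (σ := σ₂) (u := fun m => (f m).1.1) hf.2 h), ?_, ?_⟩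
    · rintro _ _ ⟨m, rfl, rfl⟩
      exact (f m).2
    · rfl

end StanleyFeray

theorem theorem2 (n l : ℕ) (hl : l ≤ n) (lam : YoungDiagram)
    (T : Fin n ≃ {b // b ∈ lam.cells}) (π : Equiv.Perm (Fin l)) :
    StanleyFeray.normalizedCharacter T hl π =
      ∑ p : Equiv.Perm (Fin l) × Equiv.Perm (Fin l) with p.1 * p.2 = π,
        (-1 : ℂ) ^ StanleyFeray.absLength p.1 *
          (StanleyFeray.numColorings lam p.1 p.2 : ℂ) := by
  classical
  rw [StanleyFeray.normalizedCharacter_eq_sum]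
  simp only [StanleyFeray.signedFactorizations, ← Finset.filter_filter]
  simp only [Finset.sum_filter (p := fun p : _ × _ => StanleyFeray.PreservesFilling _ p.1 p.2)]
  rw [Finset.sum_comm]
  refine Finset.sum_congr rfl fun p _ => ?_
  rw [StanleyFeray.neg_one_pow_absLength, ← StanleyFeray.card_preservesFilling_eq_numColorings,
    ← Finset.sum_filter, Finset.sum_const, nsmul_eq_mul, mul_comm]
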